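/- Let $(E,d)$ be a Polish space (the topology being the one of the distance $d$) with $d\le 1$, equipped with its Borel $\sigma$-algebra. Let $W_d(\mu,\nu)=\inf_{\lambda}\int_{E\times E} d(x,y)\,\lambda(dx,dy)$ be the Wasserstein distance between probability measures on $E$, the infimum being over all couplings $\lambda$ of $\mu$ and $\nu$. Let $P$ be a Markov kernel on $E$. A coupling kernel for $P$ is a Markov kernel $Q$ on $E\times E$ such that $Q((x,y),\cdot)$ is a coupling of $P(x,\cdot)$ and $P(y,\cdot)$ for all $x,y\in E$. Let $\phi:[0,\infty)\to[0,\infty)$ be concave, increasing, continuously differentiable on $[1,\infty)$, with $\phi(t)\to\infty$ and $\phi'(t)\to 0$ as $t\to\infty$. Put $H_\phi(t)=\int_1^t ds/\phi(s)$ for $t\ge 1$, and let $R=H_\phi^{\leftarrow}:[0,\infty)\to[1,\infty)$ be the inverse function of $H_\phi$. Let $\Delta\subseteq E\times E$ be measurable, $\ell\ge 1$ an integer, $\varepsilon\in(0,1)$, and $V:E\to[1,\infty)$ measurable. Assume: (A1) there is a coupling kernel $Q$ for $P$ such that $Qd(x,y)\le d(x,y)$ for all $x,y\in E$ and $Q^\ell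 d(x,y)\le(1-\varepsilon)d(x,y)$ for all $(x,y)\in\Delta$; (A2) $\sup_{(x,y)\in\Delta}\{V(x)+V(y)\}<\infty$, and there is a constant $b<\infty$ such that for all $x,y\in E$ $$PV(x)+PV(y)\le V(x)+V(y)-\phi(V(x)+V(y))+b\,\mathbf 1_\Delta(x,y).$$ Let $\pi$ be an invariant probability measure of $P$. Then: (i) there is a constant $C$ such that for all $x\in E$ and all integers $n\ge 0$ $$W_d(P^n(x,\cdot),\pi)\le \frac{C(V(x)+1)}{H_\phi^{\leftarrow}(n/2)}+\frac{C}{\phi(H_\phi^{\leftarrow}(n/2))}+\frac{C}{v_n},\qquad v_n=R\!\left(\frac{-n\log(1-\varepsilon)}{2(\log R(n)-\log(1-\varepsilon))}\right);$$ (ii) for every $\delta\in(0,1)$ there is a constant $C_\delta$ such that for all $x\in E$ and all integers $n\ge 0$ $$W_d(P^n(x,\cdot),\pi)\le \frac{C_\delta(V(x)+1)}{R(n)^\delta}+\frac{C_\delta}{\phi(R(n)^\delta)}.$$ -/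

import Mathlib

open MeasureTheory ProbabilityTheory Filter Topology
open scoped ENNReal

namespace SubgeoWasserstein

/-- The couplings of `μ` and `ν`: measures on the product with marginals `μ` and `ν`. -/
def couplings {E : Type*} [MeasurableSpace E] (μ ν : Measure E) : Set (Measure (E × E)) :=
  {γ | γ.map Prod.fst = μ ∧ γ.map Prod.snd = ν}

/-- The Wasserstein distance `W_d` associated with the distance `d` of `E`: the infimum of
`∫ d(x,y) γ(dx,dy)` over all couplings `γ` of `μ` and `ν`. -/
noncomputable def wasserstein {E : Type*} [MetricSpace E] [MeasurableSpace E]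
    (μ ν : Measure E) : ℝ≥0∞ :=
  ⨅ γ ∈ couplings μ ν, ∫⁻ p, edist p.1 p.2 ∂γ

/-- `Q` is a coupling kernel for `P`: `Q((x,y), ·)` is a coupling of `P(x, ·)` and `P(y, ·)`. -/
def IsCouplingKernel {E : Type*} [MeasurableSpace E]
    (P : Kernel E E) (Q : Kernel (E × E) (E × E)) : Prop :=
  ∀ x y : E, Q (x, y) ∈ couplings (P x) (P y)

/-- `P` has a coupling kernel `Q` with `Q d ≤ d` everywhere, and
`Q^ℓ d ≤ (1 - ε) d` on the set `Δ`. -/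
def ContractionCondition {E : Type*} [MetricSpace E] [MeasurableSpace E]
    (P : Kernel E E) (Δ : Set (E × E)) (ℓ : ℕ) (ε : ℝ) : Prop :=
  ∃ Q : Kernel (E × E) (E × E), IsCouplingKernel P Q ∧
    (∀ x y : E, ∫⁻ p, edist p.1 p.2 ∂(Q (x, y)) ≤ edist x y) ∧
    (∀ x y : E, (x, y) ∈ Δ →
      ∫⁻ p, edist p.1 p.2 ∂((Q ^ ℓ) (x, y)) ≤ ENNReal.ofReal (1 - ε) * edist x y)

/-- The class of functions `φ : ℝ₊ → ℝ₊` that are concave, increasing, continuously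
differentiable on `[1, ∞)`, with `φ(t) → ∞` and `φ'(t) → 0` as `t → ∞`.
Values at negative reals are irrelevant. -/
structure IsSubgeoRate (φ : ℝ → ℝ) : Prop where
  nonneg : ∀ t, 0 ≤ t → 0 ≤ φ t
  concaveOn : ConcaveOn ℝ (Set.Ici 0) φ
  strictMonoOn : StrictMonoOn φ (Set.Ici 0)
  contDiffOn : ContDiffOn ℝ 1 φ (Set.Ici 1)
  tendsto_atTop : Tendsto φ atTop atTop
  tendsto_deriv : Tendsto (deriv φ) atTop (𝓝 0)

open Classical in
/-- The double drift condition: for some constant `b`,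
`PV(x) + PV(y) ≤ V(x) + V(y) - φ(V(x) + V(y)) + b 1_Δ(x,y)` for all `x, y`, and `V(x) + V(y)` is
bounded on `Δ`. As `PV` is written as a `[0,∞]`-valued integral, it is finite under this condition;
as `V ≥ 1`, the left-hand side is at least `2` for a Markov kernel, so the truncation of the
right-hand side at `0` changes nothing. -/
def DriftCondition {E : Type*} [MeasurableSpace E]
    (P : Kernel E E) (Δ : Set (E × E)) (φ : ℝ → ℝ) (V : E → ℝ) : Prop :=
  (∃ b : ℝ, ∀ x y : E,
    ∫⁻ z, ENNReal.ofReal (V z) ∂(P x) + ∫⁻ z, ENNReal.ofReal (V z) ∂(P y) ≤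
      ENNReal.ofReal (V x + V y - φ (V x + V y) + b * (if (x, y) ∈ Δ then 1 else 0))) ∧
  BddAbove ((fun p : E × E => V p.1 + V p.2) '' Δ)

/-- `H_φ(t) = ∫_1^t ds / φ(s)`. -/
noncomputable def H (φ : ℝ → ℝ) (t : ℝ) : ℝ := ∫ s in (1 : ℝ)..t, 1 / φ s

/-- `H_φ^←`, the inverse of `H_φ : [1, ∞) → [0, ∞)`. -/
noncomputable def Hinv (φ : ℝ → ℝ) (s : ℝ) : ℝ := Function.invFunOn (H φ) (Set.Ici 1) s

/-- `v_n = R(-n log(1-ε) / (2 (log R(n) - log(1-ε))))` with `R = H_φ^←`. -/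
noncomputable def vRate (φ : ℝ → ℝ) (ε : ℝ) (n : ℕ) : ℝ :=
  Hinv φ (-(n : ℝ) * Real.log (1 - ε) / (2 * (Real.log (Hinv φ n) - Real.log (1 - ε))))

end SubgeoWasserstein

namespace SubgeoWasserstein

/-! ### The rate `φ`, its primitive `H`, and the convex inverse `R = Hinv φ`. -/

namespace IsSubgeoRate

variable {φ : ℝ → ℝ}

/-! Starting the coupling kernel from `δ_x ⊗ π` gives `W_d(P^n(x,·), π) ≤ ∫ Q^n d(x,y) π(dy)`
(`wasserstein_pow_le`), so `Q^n d` has to be bounded in terms of `W(x,y) = V(x) + V(y)`.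

The functions `G_k(w) = R(H(w) + k)` turn the drift into return-time estimates. They are concave,
and `H(w - φ(w)) ≤ H(w) - 1`; hence, by Jensen, `Q G_{k+1}(W) ≤ G_k(W)` off `Δ`. Since `R(k) ≤
G_k(W)`, this controls the mean of `R(τ)` for the return time `τ` to `Δ`. No stopping times appear:
every estimate is an induction on the number of remaining steps, with the elapsed time `k` as a
parameter.

For (i), either `m` contractions have taken place by time `n`, giving `(1-ε)^m`, or the excursions
were long. In the latter case convexity of `R` makes the sum of the `R(τ_i)` at least `m R(n/(2m))`,
or the first visit to `Δ` takes longer than `n/2`; Markov's inequality bounds both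
(`lintegral_pow_le_excursions`, `lintegral_pow_le_add`). Choosing `m` of order `log R(n)` gives
`v_n`.

For (ii), Hölder's inequality lets `d^(1-δ) G_k(W)^δ` play the role of a supermartingale: `R` grows
subexponentially, so for large `k` the contraction of `d` on `Δ` pays for the bounded time shift
caused by a visit to `Δ` (`exists_lintegral_pow_le_rpow`).

Finally `∫ φ(V) dπ < ∞` (`lintegral_rate_le`), and a bound by `1 ∧ V(y)/S` integrates to order
`1/φ(S)` (`lintegral_le_of_le_one`). -/

theorem pos (hφ : IsSubgeoRate φ) {t : ℝ} (ht : 0 < t) : 0 < φ t :=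
  (hφ.nonneg 0 le_rfl).trans_lt (hφ.strictMonoOn (Set.mem_Ici.2 le_rfl) ht.le ht)

theorem mono (hφ : IsSubgeoRate φ) {s t : ℝ} (hs : 0 ≤ s) (hst : s ≤ t) : φ s ≤ φ t :=
  hφ.strictMonoOn.monotoneOn hs (hs.trans hst) hst

/-- By concavity and `φ(0) ≥ 0`, the quotient `φ(t)/t` is nonincreasing. -/
theorem mul_apply_le_mul_apply (hφ : IsSubgeoRate φ) {s t : ℝ} (hs : 0 < s) (hst : s ≤ t) :
    s * φ t ≤ t * φ s := by
  have ht : 0 < t := hs.trans_le hst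
  have h := hφ.concaveOn.2 (Set.mem_Ici.2 ht.le) (Set.mem_Ici.2 (le_refl (0 : ℝ)))
    (div_nonneg hs.le ht.le)
    (sub_nonneg.2 ((div_le_one ht).2 hst)) (add_sub_cancel _ _)
  simp only [smul_eq_mul, mul_zero, add_zero, div_mul_cancel₀ _ ht.ne'] at h
  have h0 : 0 ≤ (1 - s / t) * φ 0 :=
    mul_nonneg (sub_nonneg.2 ((div_le_one ht).2 hst)) (hφ.nonneg 0 le_rfl)
  calc s * φ t = t * (s / t * φ t) := by field_simp
    _ ≤ t * φ s := by gcongr; linarith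

theorem continuousOn (hφ : IsSubgeoRate φ) : ContinuousOn φ (Set.Ioi 0) :=
  (hφ.concaveOn.subset Set.Ioi_subset_Ici_self (convex_Ioi 0)).continuousOn isOpen_Ioi

theorem differentiableAt (hφ : IsSubgeoRate φ) {t : ℝ} (ht : 1 < t) : DifferentiableAt ℝ φ t :=
  (hφ.contDiffOn.differentiableOn (by norm_num)).differentiableAt (Ici_mem_nhds ht)

theorem antitoneOn_deriv (hφ : IsSubgeoRate φ) : AntitoneOn (deriv φ) (Set.Ioi 1) :=
  (hφ.concaveOn.subset (fun t (ht : 1 < t) => Set.mem_Ici.2 (by linarith))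
    (convex_Ioi 1)).antitoneOn_deriv (fun _ ht => hφ.differentiableAt ht)

theorem continuousOn_inv (hφ : IsSubgeoRate φ) :
    ContinuousOn (fun s => 1 / φ s) (Set.Ioi 0) :=
  continuousOn_const.div hφ.continuousOn (fun _ hs => (hφ.pos hs).ne')

theorem uIcc_subset {u v : ℝ} (hu : 0 < u) (hv : 0 < v) : Set.uIcc u v ⊆ Set.Ioi 0 :=
  fun _ hx => (lt_min hu hv).trans_le hx.1

theorem intervalIntegrable_inv (hφ : IsSubgeoRate φ) {u v : ℝ} (hu : 0 < u) (hv : 0 < v) :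
    IntervalIntegrable (fun s => 1 / φ s) volume u v :=
  (hφ.continuousOn_inv.mono (uIcc_subset hu hv)).intervalIntegrable

theorem H_sub_H (hφ : IsSubgeoRate φ) {u v : ℝ} (hu : 0 < u) (hv : 0 < v) :
    H φ u - H φ v = ∫ s in v..u, 1 / φ s :=
  intervalIntegral.integral_interval_sub_left (hφ.intervalIntegrable_inv one_pos hu)
    (hφ.intervalIntegrable_inv one_pos hv)

theorem H_one : H φ 1 = 0 := by simp [H]

/-- The integrand `1/φ` decreases, so `H` is concave and lies below its tangent at `v`. -/
theorem H_sub_H_le (hφ : IsSubgeoRate φ) {u v : ℝ} (hu : 0 < u) (hv : 0 < v) :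
    H φ u - H φ v ≤ (u - v) / φ v := by
  rcases le_total v u with h | h
  · rw [hφ.H_sub_H hu hv]
    calc ∫ s in v..u, 1 / φ s ≤ ∫ _ in v..u, 1 / φ v :=
          intervalIntegral.integral_mono_on h (hφ.intervalIntegrable_inv hv hu) (by simp)
            fun x hx => one_div_le_one_div_of_le (hφ.pos hv) (hφ.mono hv.le hx.1)
      _ = (u - v) / φ v := by simp [div_eq_mul_inv]
  · have : (v - u) / φ v ≤ H φ v - H φ u := by
      rw [hφ.H_sub_H hv hu]
      calc (v - u) / φ v = ∫ _ in u..v, 1 / φ v := by simp [div_eq_mul_inv]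
        _ ≤ ∫ s in u..v, 1 / φ s :=
          intervalIntegral.integral_mono_on h (by simp) (hφ.intervalIntegrable_inv hu hv)
            fun x hx => one_div_le_one_div_of_le (hφ.pos (hu.trans_le hx.1))
              (hφ.mono (hu.le.trans hx.1) hx.2)
    have h2 : (u - v) / φ v = -((v - u) / φ v) := by ring
    linarith

theorem H_strictMonoOn (hφ : IsSubgeoRate φ) : StrictMonoOn (H φ) (Set.Ici 1) := by
  intro u hu v hv huv
  have hu0 : (0 : ℝ) < u := zero_lt_one.trans_le hu
  have hv0 : (0 : ℝ) < v := zero_lt_one.trans_le hv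
  have h1 := hφ.H_sub_H_le hu0 hv0
  have h2 : (u - v) / φ v < 0 := div_neg_of_neg_of_pos (by linarith) (hφ.pos hv0)
  linarith

theorem hasDerivAt_H (hφ : IsSubgeoRate φ) {t : ℝ} (ht : 0 < t) :
    HasDerivAt (H φ) (1 / φ t) t :=
  intervalIntegral.integral_hasDerivAt_right (hφ.intervalIntegrable_inv one_pos ht)
    (hφ.continuousOn_inv.stronglyMeasurableAtFilter isOpen_Ioi t ht)
    (hφ.continuousOn_inv.continuousAt (Ioi_mem_nhds ht))

/-- Since `φ(s) ≤ s φ(1)` for `s ≥ 1`, `H` grows at least like a multiple of the logarithm. -/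
theorem tendsto_H (hφ : IsSubgeoRate φ) : Tendsto (H φ) atTop atTop := by
  have h1 : 0 < φ 1 := hφ.pos one_pos
  refine tendsto_atTop_mono' _ (f₁ := fun t => 1 / φ 1 * Real.log t) ?_
    (Real.tendsto_log_atTop.const_mul_atTop (by positivity))
  filter_upwards [eventually_ge_atTop 1] with t ht
  have ht0 : (0 : ℝ) < t := by linarith
  calc 1 / φ 1 * Real.log t = ∫ s in (1 : ℝ)..t, 1 / φ 1 * (1 / s) := by
        rw [intervalIntegral.integral_const_mul, integral_one_div_of_pos one_pos ht0, div_one]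
    _ ≤ H φ t := by
        refine intervalIntegral.integral_mono_on ht ?_ (hφ.intervalIntegrable_inv one_pos ht0) ?_
        · refine ContinuousOn.intervalIntegrable (continuousOn_const.mul
            (continuousOn_const.div continuousOn_id fun x hx => ?_))
          exact (uIcc_subset one_pos ht0 hx).ne'
        · intro x hx
          have hx0 : 0 < x := by linarith [hx.1]
          rw [one_div_mul_one_div]
          apply one_div_le_one_div_of_le (hφ.pos hx0)
          have := hφ.mul_apply_le_mul_apply one_pos hx.1
          linarith

theorem H_nonneg (hφ : IsSubgeoRate φ) {u : ℝ} (hu : 1 ≤ u) : 0 ≤ H φ u := by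
  rw [← H_one (φ := φ)]
  exact hφ.H_strictMonoOn.monotoneOn Set.self_mem_Ici hu hu

theorem H_surjOn (hφ : IsSubgeoRate φ) : Set.SurjOn (H φ) (Set.Ici 1) (Set.Ici 0) := by
  intro s hs
  obtain ⟨t, ht, hst⟩ := ((eventually_ge_atTop (1 : ℝ)).and
    (hφ.tendsto_H.eventually_ge_atTop s)).exists
  have hc : ContinuousOn (H φ) (Set.Icc 1 t) := fun x hx =>
    (hφ.hasDerivAt_H (zero_lt_one.trans_le hx.1)).continuousAt.continuousWithinAt
  obtain ⟨u, hu, hus⟩ := intermediate_value_Icc ht hc ⟨by rw [H_one]; exact hs, hst⟩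
  exact ⟨u, hu.1, hus⟩

theorem one_le_Hinv (hφ : IsSubgeoRate φ) {s : ℝ} (hs : 0 ≤ s) : 1 ≤ Hinv φ s :=
  Function.invFunOn_mem (hφ.H_surjOn hs)

theorem Hinv_pos (hφ : IsSubgeoRate φ) {s : ℝ} (hs : 0 ≤ s) : 0 < Hinv φ s :=
  zero_lt_one.trans_le (hφ.one_le_Hinv hs)

theorem H_Hinv (hφ : IsSubgeoRate φ) {s : ℝ} (hs : 0 ≤ s) : H φ (Hinv φ s) = s :=
  Function.invFunOn_eq (hφ.H_surjOn hs)

theorem Hinv_H (hφ : IsSubgeoRate φ) {u : ℝ} (hu : 1 ≤ u) : Hinv φ (H φ u) = u :=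
  hφ.H_strictMonoOn.injOn (hφ.one_le_Hinv (hφ.H_nonneg hu)) hu (hφ.H_Hinv (hφ.H_nonneg hu))

theorem Hinv_mono (hφ : IsSubgeoRate φ) {s t : ℝ} (hs : 0 ≤ s) (hst : s ≤ t) :
    Hinv φ s ≤ Hinv φ t := by
  have ht := hs.trans hst
  rwa [← hφ.H_strictMonoOn.le_iff_le (hφ.one_le_Hinv hs) (hφ.one_le_Hinv ht), hφ.H_Hinv hs,
    hφ.H_Hinv ht]

theorem Hinv_zero (hφ : IsSubgeoRate φ) : Hinv φ 0 = 1 := by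
  have := hφ.Hinv_H le_rfl
  rwa [H_one] at this

/-- The tangent line of the convex function `Hinv φ` lies below it. -/
theorem tangent_le_Hinv (hφ : IsSubgeoRate φ) {s t : ℝ} (hs : 0 ≤ s) (ht : 0 ≤ t) :
    Hinv φ s + φ (Hinv φ s) * (t - s) ≤ Hinv φ t := by
  have h := hφ.H_sub_H_le (hφ.Hinv_pos ht) (hφ.Hinv_pos hs)
  rw [hφ.H_Hinv hs, hφ.H_Hinv ht, le_div_iff₀ (hφ.pos (hφ.Hinv_pos hs))] at h
  linarith

theorem convexOn_Hinv (hφ : IsSubgeoRate φ) : ConvexOn ℝ (Set.Ici 0) (Hinv φ) := by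
  refine ⟨convex_Ici 0, fun x hx y hy a b ha hb hab => ?_⟩
  have hz : 0 ≤ a • x + b • y := (convex_Ici (0 : ℝ)) hx hy ha hb hab
  simp only [smul_eq_mul] at hz ⊢
  have h1 := mul_le_mul_of_nonneg_left (hφ.tangent_le_Hinv hz hx) ha
  have h2 := mul_le_mul_of_nonneg_left (hφ.tangent_le_Hinv hz hy) hb
  obtain rfl : b = 1 - a := by linarith
  nlinarith

theorem hasDerivAt_Hinv (hφ : IsSubgeoRate φ) {s : ℝ} (hs : 0 < s) :
    HasDerivAt (Hinv φ) (φ (Hinv φ s)) s := by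
  have hc : ContinuousAt (Hinv φ) s :=
    ((hφ.convexOn_Hinv.subset Set.Ioi_subset_Ici_self (convex_Ioi 0)).continuousOn
      isOpen_Ioi).continuousAt (Ioi_mem_nhds hs)
  have h := HasDerivAt.of_local_left_inverse hc (hφ.hasDerivAt_H (hφ.Hinv_pos hs.le))
    (one_div_pos.2 (hφ.pos (hφ.Hinv_pos hs.le))).ne'
    ((eventually_gt_nhds hs).mono fun y hy => hφ.H_Hinv hy.le)
  simpa using h

end IsSubgeoRate

/-! ### The drift functions `G φ k`: monotonicity, one-step decrease, concavity. -/

/-- The drift functions `w ↦ R(H(w) + k)`, where `R` is the inverse of `H`. -/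
noncomputable def G (φ : ℝ → ℝ) (k w : ℝ) : ℝ := Hinv φ (H φ w + k)

namespace IsSubgeoRate

variable {φ : ℝ → ℝ}

theorem Hinv_le_G (hφ : IsSubgeoRate φ) {k w : ℝ} (hk : 0 ≤ k) (hw : 1 ≤ w) :
    Hinv φ k ≤ G φ k w :=
  hφ.Hinv_mono hk (by linarith [hφ.H_nonneg hw])

theorem one_le_G (hφ : IsSubgeoRate φ) {k w : ℝ} (hk : 0 ≤ k) (hw : 1 ≤ w) : 1 ≤ G φ k w :=
  (hφ.one_le_Hinv hk).trans (hφ.Hinv_le_G hk hw)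

theorem G_zero (hφ : IsSubgeoRate φ) {w : ℝ} (hw : 1 ≤ w) : G φ 0 w = w := by
  rw [G, add_zero, hφ.Hinv_H hw]

theorem le_G (hφ : IsSubgeoRate φ) {k w : ℝ} (hk : 0 ≤ k) (hw : 1 ≤ w) : w ≤ G φ k w := by
  conv_lhs => rw [← hφ.Hinv_H hw]
  exact hφ.Hinv_mono (hφ.H_nonneg hw) (by linarith)

theorem G_mono (hφ : IsSubgeoRate φ) {k w w' : ℝ} (hk : 0 ≤ k) (hw : 1 ≤ w) (h : w ≤ w') :
    G φ k w ≤ G φ k w' :=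
  hφ.Hinv_mono (by linarith [hφ.H_nonneg hw])
    (by linarith [hφ.H_strictMonoOn.monotoneOn hw (hw.trans h) h])

theorem G_succ_sub_le (hφ : IsSubgeoRate φ) {k w : ℝ} (hk : 0 ≤ k) (hw0 : 0 < w)
    (hw : 1 ≤ w - φ w) :
    G φ (k + 1) (w - φ w) ≤ G φ k w := by
  have h := hφ.H_sub_H_le (u := w - φ w) (v := w) (by linarith) hw0
  have h2 : (w - φ w - w) / φ w = -1 := by
    rw [div_eq_iff (hφ.pos hw0).ne']; ring
  exact hφ.Hinv_mono (by linarith [hφ.H_nonneg hw]) (by linarith)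

theorem hasDerivAt_G (hφ : IsSubgeoRate φ) {k w : ℝ} (hk : 0 ≤ k) (hw : 1 < w) :
    HasDerivAt (G φ k) (φ (G φ k w) / φ w) w := by
  have hH : 0 < H φ w := by
    rw [← H_one (φ := φ)]
    exact hφ.H_strictMonoOn Set.self_mem_Ici hw.le hw
  have h1 := (hφ.hasDerivAt_H (t := w) (by linarith)).add_const k
  have h2 := (hφ.hasDerivAt_Hinv (s := H φ w + k) (by linarith)).comp w h1
  rw [mul_one_div] at h2
  exact h2

/-- With `G = G φ k w`, the derivative of this quotient is `φ(G) (φ'(G) - φ'(w)) / φ(w)^2`, which is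
nonpositive because `φ'` decreases and `G ≥ w`. -/
theorem antitoneOn_deriv_G (hφ : IsSubgeoRate φ) {k : ℝ} (hk : 0 ≤ k) :
    AntitoneOn (fun w => φ (G φ k w) / φ w) (Set.Ioi 1) := by
  have hpos : ∀ w : ℝ, 1 < w → 0 < φ w := fun w hw => hφ.pos (by linarith)
  have hG1 : ∀ w : ℝ, 1 < w → 1 < G φ k w := fun w hw => hw.trans_le (hφ.le_G hk hw.le)
  have hder : ∀ w ∈ Set.Ioi (1 : ℝ), HasDerivAt (fun w => φ (G φ k w) / φ w)
      ((deriv φ (G φ k w) * (φ (G φ k w) / φ w) * φ w - φ (G φ k w) * deriv φ w) / φ w ^ 2) w :=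
    fun w hw => ((hφ.differentiableAt (hG1 w hw)).hasDerivAt.comp w
      (hφ.hasDerivAt_G hk hw)).div (hφ.differentiableAt hw).hasDerivAt (hpos w hw).ne'
  refine antitoneOn_of_deriv_nonpos (convex_Ioi 1)
    (fun w hw => (hder w hw).continuousAt.continuousWithinAt) ?_ ?_
  · rw [interior_Ioi]
    exact fun w hw => (hder w hw).differentiableAt.differentiableWithinAt
  · rw [interior_Ioi]
    intro w hw
    rw [(hder w hw).deriv]
    have h1 := hφ.antitoneOn_deriv hw (hG1 w hw) (hφ.le_G hk (le_of_lt hw))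
    have h2 := hpos w hw
    have h3 := hpos _ (hG1 w hw)
    refine div_nonpos_of_nonpos_of_nonneg ?_ (by positivity)
    have h4 : deriv φ (G φ k w) * (φ (G φ k w) / φ w) * φ w
        = φ (G φ k w) * deriv φ (G φ k w) := by field_simp
    rw [h4]
    nlinarith

theorem concaveOn_G (hφ : IsSubgeoRate φ) {k : ℝ} (hk : 0 ≤ k) :
    ConcaveOn ℝ (Set.Ioi 1) (G φ k) := by
  refine AntitoneOn.concaveOn_of_deriv (convex_Ioi 1)
    (fun w hw => (hφ.hasDerivAt_G hk hw).continuousAt.continuousWithinAt) ?_ ?_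
  · rw [interior_Ioi]
    exact fun w hw => (hφ.hasDerivAt_G hk hw).differentiableAt.differentiableWithinAt
  · rw [interior_Ioi]
    exact (hφ.antitoneOn_deriv_G hk).congr fun w hw => (hφ.hasDerivAt_G hk hw).deriv.symm

theorem exists_G_le_tangent (hφ : IsSubgeoRate φ) {k w₀ : ℝ} (hk : 0 ≤ k) (hw₀ : 1 < w₀) :
    ∃ g : ℝ, 0 ≤ g ∧ ∀ w, 1 < w → G φ k w + g * w₀ ≤ G φ k w₀ + g * w := by
  have hg := hφ.hasDerivAt_G hk hw₀
  refine ⟨φ (G φ k w₀) / φ w₀, div_nonneg (hφ.nonneg _ ?_) (hφ.nonneg _ (by linarith)), ?_⟩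
  · linarith [hφ.one_le_G hk hw₀.le]
  intro w hw
  rcases lt_trichotomy w w₀ with h | h | h
  · have := (hφ.concaveOn_G hk).le_slope_of_hasDerivAt hw hw₀ h hg
    rw [slope_def_field, le_div_iff₀ (by linarith)] at this
    linarith
  · rw [h]
  · have := (hφ.concaveOn_G hk).slope_le_of_hasDerivAt hw₀ hw h hg
    rw [slope_def_field, div_le_iff₀ (by linarith)] at this
    linarith

/-- Beyond a point `u₁` where `φ' < η/2`, concavity keeps the slope of chords from `u₁` below `η/2`;
the other half of `η u` absorbs `φ(u₁)`. -/
theorem eventually_le_mul (hφ : IsSubgeoRate φ) {η : ℝ} (hη : 0 < η) :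
    ∀ᶠ u in atTop, φ u ≤ η * u := by
  obtain ⟨u₁, hu₁, hd⟩ := ((eventually_gt_atTop (1 : ℝ)).and
    (hφ.tendsto_deriv.eventually_lt_const (half_pos hη))).exists
  filter_upwards [eventually_gt_atTop u₁, eventually_ge_atTop (φ u₁ / (η / 2))] with u hu hu2
  have h1 : (0 : ℝ) < u₁ := by linarith
  have := hφ.concaveOn.slope_le_deriv (Set.mem_Ici.2 h1.le)
    (Set.mem_Ici.2 (by linarith : (0 : ℝ) ≤ u)) hu (hφ.differentiableAt hu₁)
  rw [slope_def_field, div_le_iff₀ (by linarith)] at this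
  rw [div_le_iff₀ (by linarith)] at hu2
  nlinarith

theorem tendsto_Hinv (hφ : IsSubgeoRate φ) : Tendsto (Hinv φ) atTop atTop := by
  have h1 : 0 < φ 1 := hφ.pos one_pos
  refine tendsto_atTop_mono' _ (f₁ := fun t => φ 1 * t) ?_ (tendsto_id.const_mul_atTop h1)
  filter_upwards [eventually_ge_atTop 0] with t ht
  have := hφ.tangent_le_Hinv le_rfl ht
  rw [hφ.Hinv_zero] at this
  linarith

/-- Subexponential growth of `R`: the tangent at `k + c` gives `R(k) ≥ R(k+c) - c φ(R(k+c))`, and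
`φ(u) = o(u)`. -/
theorem eventually_Hinv_add_le (hφ : IsSubgeoRate φ) {c q : ℝ} (hc : 0 ≤ c) (hq : 1 < q) :
    ∀ᶠ k in atTop, Hinv φ (k + c) ≤ q * Hinv φ k := by
  have hη : 0 < (1 - q⁻¹) / (c + 1) :=
    div_pos (sub_pos.2 (inv_lt_one_of_one_lt₀ hq)) (by linarith)
  filter_upwards [eventually_ge_atTop 0, ((hφ.tendsto_Hinv.comp
    (tendsto_atTop_add_const_right _ c tendsto_id)).eventually (hφ.eventually_le_mul hη))]
    with k hk h
  simp only [Function.comp_apply, id] at h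
  have h1 := hφ.tangent_le_Hinv (s := k + c) (t := k) (by linarith) hk
  have hR := hφ.Hinv_pos (s := k + c) (by linarith)
  have h2 : c * φ (Hinv φ (k + c)) ≤ (1 - q⁻¹) * Hinv φ (k + c) := by
    calc c * φ (Hinv φ (k + c)) ≤ (c + 1) * φ (Hinv φ (k + c)) := by
          have := hφ.pos hR
          nlinarith
      _ ≤ (c + 1) * ((1 - q⁻¹) / (c + 1) * Hinv φ (k + c)) := by gcongr
      _ = (1 - q⁻¹) * Hinv φ (k + c) := by field_simp
  have h3 : q⁻¹ * Hinv φ (k + c) ≤ Hinv φ k := by nlinarith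
  rwa [inv_mul_le_iff₀ (by linarith)] at h3

end IsSubgeoRate

/-! ### Jensen's inequality for `G φ k`, and powers of kernels. -/

theorem IsSubgeoRate.measurable_G {φ : ℝ → ℝ} (hφ : IsSubgeoRate φ) {Z : Type*}
    [MeasurableSpace Z] {W : Z → ℝ} (hW : Measurable W) (hW1 : ∀ z, 1 ≤ W z) {k : ℝ}
    (hk : 0 ≤ k) : Measurable fun z => G φ k (W z) := by
  have hm : Monotone fun w => G φ k (max w 1) := fun w w' h =>
    hφ.G_mono hk (le_max_right _ _) (max_le_max_right 1 h)
  simpa [Function.comp_def, max_eq_left (hW1 _)] using hm.measurable.comp hW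

/-- Jensen's inequality for the concave functions `G φ k`. -/
theorem IsSubgeoRate.lintegral_G_le {φ : ℝ → ℝ} (hφ : IsSubgeoRate φ) {Z : Type*}
    [MeasurableSpace Z] {W : Z → ℝ} (hW : Measurable W) (hW1 : ∀ z, 1 < W z)
    (μ : Measure Z) [IsProbabilityMeasure μ] {k w₀ : ℝ} (hk : 0 ≤ k) (hw₀ : 1 < w₀)
    (h : ∫⁻ z, ENNReal.ofReal (W z) ∂μ ≤ ENNReal.ofReal w₀) :
    ∫⁻ z, ENNReal.ofReal (G φ k (W z)) ∂μ ≤ ENNReal.ofReal (G φ k w₀) := by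
  obtain ⟨g, hg, htan⟩ := hφ.exists_G_le_tangent hk hw₀
  have hGm := (hφ.measurable_G hW (fun z => (hW1 z).le) hk).ennreal_ofReal
  have hG0 : ∀ w, 1 < w → 0 ≤ G φ k w := fun w hw => zero_le_one.trans (hφ.one_le_G hk hw.le)
  have key : ∫⁻ z, ENNReal.ofReal (G φ k (W z)) ∂μ + ENNReal.ofReal (g * w₀)
      ≤ ENNReal.ofReal (G φ k w₀) + ENNReal.ofReal (g * w₀) := by
    calc ∫⁻ z, ENNReal.ofReal (G φ k (W z)) ∂μ + ENNReal.ofReal (g * w₀)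
        = ∫⁻ z, (ENNReal.ofReal (G φ k (W z)) + ENNReal.ofReal (g * w₀)) ∂μ := by
          rw [lintegral_add_left hGm]; simp
      _ ≤ ∫⁻ z, (ENNReal.ofReal (G φ k w₀) + ENNReal.ofReal g * ENNReal.ofReal (W z)) ∂μ := by
          refine lintegral_mono fun z => ?_
          rw [← ENNReal.ofReal_add (hG0 _ (hW1 z)) (mul_nonneg hg (by linarith)),
            ← ENNReal.ofReal_mul hg, ← ENNReal.ofReal_add (hG0 _ hw₀)
              (mul_nonneg hg (by linarith [hW1 z]))]
          exact ENNReal.ofReal_le_ofReal (htan _ (hW1 z))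
      _ = ENNReal.ofReal (G φ k w₀) + ENNReal.ofReal g * ∫⁻ z, ENNReal.ofReal (W z) ∂μ := by
          rw [lintegral_add_left measurable_const, lintegral_const_mul _ hW.ennreal_ofReal]
          simp
      _ ≤ ENNReal.ofReal (G φ k w₀) + ENNReal.ofReal (g * w₀) := by
          rw [ENNReal.ofReal_mul hg]
          gcongr
  exact (ENNReal.add_le_add_iff_right ENNReal.ofReal_ne_top).1 key

theorem lintegral_pow_add {Z : Type*} [MeasurableSpace Z] (Q : Kernel Z Z) {d : Z → ℝ≥0∞}
    (hd : Measurable d) (m n : ℕ) (z : Z) :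
    ∫⁻ p, d p ∂((Q ^ (m + n)) z) = ∫⁻ y, ∫⁻ p, d p ∂((Q ^ m) y) ∂((Q ^ n) z) := by
  rw [Kernel.pow_add, Kernel.lintegral_comp _ _ _ hd]

instance isMarkovKernel_pow {Z : Type*} [MeasurableSpace Z] (Q : Kernel Z Z) [IsMarkovKernel Q]
    (n : ℕ) : IsMarkovKernel (Q ^ n) := by
  induction n with
  | zero => exact inferInstanceAs (IsMarkovKernel Kernel.id)
  | succ n ih => exact inferInstanceAs (IsMarkovKernel ((Q ^ n) ∘ₖ Q))

theorem lintegral_pow_zero {Z : Type*} [MeasurableSpace Z] (Q : Kernel Z Z) {d : Z → ℝ≥0∞}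
    (hd : Measurable d) (z : Z) : ∫⁻ p, d p ∂((Q ^ 0) z) = d z := by
  have h : Q ^ 0 = Kernel.id := pow_zero Q
  rw [h, Kernel.id_apply, lintegral_dirac' z hd]

/-! ### The drift and contraction conditions on an abstract state space. -/

/-- A Markov kernel `Q` for which `d` is nonincreasing in mean, `d` is contracted in mean by `Q ^ ℓ`
on `Δ`, and `W` satisfies a subgeometric drift condition outside of `Δ`. -/
structure SubgeoDrift {Z : Type*} [MeasurableSpace Z] (φ : ℝ → ℝ) (Q : Kernel Z Z) (d : Z → ℝ≥0∞)
    (W : Z → ℝ) (Δ : Set Z) (ℓ : ℕ) (ε b M : ℝ) : Prop where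
  rate : IsSubgeoRate φ
  measurable_d : Measurable d
  measurable_W : Measurable W
  d_le_one : ∀ z, d z ≤ 1
  one_lt_W : ∀ z, 1 < W z
  one_le_period : 1 ≤ ℓ
  eps_pos : 0 < ε
  eps_lt_one : ε < 1
  b_nonneg : 0 ≤ b
  one_lt_M : 1 < M
  W_le : ∀ z ∈ Δ, W z ≤ M
  lintegral_d_le : ∀ z, ∫⁻ p, d p ∂(Q z) ≤ d z
  lintegral_pow_d_le : ∀ z ∈ Δ, ∫⁻ p, d p ∂((Q ^ ℓ) z) ≤ ENNReal.ofReal (1 - ε) * d z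
  -- Keeps the argument of `G φ k` in the half-line `(1, ∞)`, on which it is concave.
  one_lt_sub : ∀ z ∉ Δ, 1 < W z - φ (W z)
  lintegral_W_le : ∀ z ∉ Δ, ∫⁻ p, ENNReal.ofReal (W p) ∂(Q z) ≤ ENNReal.ofReal (W z - φ (W z))
  lintegral_W_le_add : ∀ z, ∫⁻ p, ENNReal.ofReal (W p) ∂(Q z) ≤ ENNReal.ofReal (W z + b)

namespace SubgeoDrift

variable {Z : Type*} [MeasurableSpace Z] {φ : ℝ → ℝ} {Q : Kernel Z Z}
  {d : Z → ℝ≥0∞} {W : Z → ℝ} {Δ : Set Z} {ℓ : ℕ} {ε b M : ℝ}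

theorem lintegral_pow_le (h : SubgeoDrift φ Q d W Δ ℓ ε b M) (n : ℕ) (z : Z) :
    ∫⁻ p, d p ∂((Q ^ n) z) ≤ d z := by
  induction n with
  | zero => rw [lintegral_pow_zero Q h.measurable_d]
  | succ n ih =>
    rw [add_comm, lintegral_pow_add Q h.measurable_d, pow_one]
    exact (lintegral_mono fun y => h.lintegral_d_le y).trans ih

theorem lintegral_pow_le_one (h : SubgeoDrift φ Q d W Δ ℓ ε b M) (n : ℕ) (z : Z) :
    ∫⁻ p, d p ∂((Q ^ n) z) ≤ 1 :=
  (h.lintegral_pow_le n z).trans (h.d_le_one z)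

theorem lintegral_pow_W_le [IsMarkovKernel Q]
    (h : SubgeoDrift φ Q d W Δ ℓ ε b M) (n : ℕ) (z : Z) :
    ∫⁻ p, ENNReal.ofReal (W p) ∂((Q ^ n) z) ≤ ENNReal.ofReal (W z + n * b) := by
  have hWm := h.measurable_W.ennreal_ofReal
  have hb := h.b_nonneg
  induction n with
  | zero => rw [lintegral_pow_zero Q hWm]; simp
  | succ n ih =>
    rw [add_comm n 1, lintegral_pow_add Q hWm, pow_one]
    calc ∫⁻ y, ∫⁻ p, ENNReal.ofReal (W p) ∂(Q y) ∂((Q ^ n) z)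
        ≤ ∫⁻ y, (ENNReal.ofReal (W y) + ENNReal.ofReal b) ∂((Q ^ n) z) := by
          refine lintegral_mono fun y => (h.lintegral_W_le_add y).trans ?_
          exact ENNReal.ofReal_add_le
      _ = ∫⁻ y, ENNReal.ofReal (W y) ∂((Q ^ n) z) + ENNReal.ofReal b := by
          rw [lintegral_add_left hWm]; simp
      _ ≤ ENNReal.ofReal (W z + n * b) + ENNReal.ofReal b := by gcongr
      _ = ENNReal.ofReal (W z + ((1 + n : ℕ) : ℝ) * b) := by
          rw [← ENNReal.ofReal_add (by have := h.one_lt_W z; positivity) hb]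
          congr 1; push_cast; ring

/-- The value of the drift function after a contraction period started from `Δ`. -/
theorem lintegral_pow_W_le_of_mem [IsMarkovKernel Q]
    (h : SubgeoDrift φ Q d W Δ ℓ ε b M) {z : Z} (hz : z ∈ Δ) :
    ∫⁻ p, ENNReal.ofReal (W p) ∂((Q ^ ℓ) z) ≤ ENNReal.ofReal (M + ℓ * b) :=
  (h.lintegral_pow_W_le ℓ z).trans (ENNReal.ofReal_le_ofReal (by linarith [h.W_le z hz]))

theorem one_lt_M_add (h : SubgeoDrift φ Q d W Δ ℓ ε b M) : 1 < M + ℓ * b := by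
  have := h.one_lt_M
  have := mul_nonneg (Nat.cast_nonneg (α := ℝ) ℓ) h.b_nonneg
  linarith

theorem measurable_G (h : SubgeoDrift φ Q d W Δ ℓ ε b M) {k : ℝ} (hk : 0 ≤ k) :
    Measurable fun z => G φ k (W z) :=
  h.rate.measurable_G h.measurable_W (fun z => (h.one_lt_W z).le) hk

/-- The form `c d + α + κ G_k(W)` survives integration, by linearity and Jensen; this is the
inductive step for all the bounds behind (i). -/
theorem lintegral_affine_le (h : SubgeoDrift φ Q d W Δ ℓ ε b M) (μ : Measure Z)
    [IsProbabilityMeasure μ] {k w₀ κ : ℝ} (hk : 0 ≤ k) (hκ : 0 ≤ κ) (hw₀ : 1 < w₀)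
    (hW : ∫⁻ z, ENNReal.ofReal (W z) ∂μ ≤ ENNReal.ofReal w₀) {c α : ℝ≥0∞}
    {f : Z → ℝ≥0∞} (hf : ∀ z, f z ≤ c * d z + α + ENNReal.ofReal (κ * G φ k (W z))) :
    ∫⁻ z, f z ∂μ ≤ c * ∫⁻ z, d z ∂μ + α + ENNReal.ofReal (κ * G φ k w₀) := by
  calc ∫⁻ z, f z ∂μ
      ≤ ∫⁻ z, (c * d z + α + ENNReal.ofReal κ * ENNReal.ofReal (G φ k (W z))) ∂μ :=
        lintegral_mono fun z => by rw [← ENNReal.ofReal_mul hκ]; exact hf z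
    _ = c * ∫⁻ z, d z ∂μ + α + ENNReal.ofReal κ * ∫⁻ z, ENNReal.ofReal (G φ k (W z)) ∂μ := by
        rw [lintegral_add_left ((h.measurable_d.const_mul c).add_const α),
          lintegral_add_left (h.measurable_d.const_mul c), lintegral_const_mul _ h.measurable_d,
          lintegral_const_mul _ (h.measurable_G hk).ennreal_ofReal]
        simp
    _ ≤ _ := by
        rw [ENNReal.ofReal_mul hκ]
        gcongr
        exact h.rate.lintegral_G_le h.measurable_W h.one_lt_W μ hk hw₀ hW

/-- Hölder with exponents `1/(1-δ)` and `1/δ`, then Jensen: the counterpart for (ii). -/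
theorem lintegral_rpow_le (h : SubgeoDrift φ Q d W Δ ℓ ε b M) (μ : Measure Z)
    [IsProbabilityMeasure μ] {k w₀ δ : ℝ} (hk : 0 ≤ k) (hδ0 : 0 < δ) (hδ1 : δ < 1) (hw₀ : 1 < w₀)
    (hW : ∫⁻ z, ENNReal.ofReal (W z) ∂μ ≤ ENNReal.ofReal w₀) :
    ∫⁻ z, d z ^ (1 - δ) * ENNReal.ofReal (G φ k (W z)) ^ δ ∂μ
      ≤ (∫⁻ z, d z ∂μ) ^ (1 - δ) * ENNReal.ofReal (G φ k w₀) ^ δ := by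
  refine (ENNReal.lintegral_mul_norm_pow_le h.measurable_d.aemeasurable
    (h.measurable_G hk).ennreal_ofReal.aemeasurable (by linarith) hδ0.le (by ring)).trans ?_
  gcongr
  exact h.rate.lintegral_G_le h.measurable_W h.one_lt_W μ hk hw₀ hW

theorem G_succ_le (h : SubgeoDrift φ Q d W Δ ℓ ε b M) {z : Z} (hz : z ∉ Δ) {k : ℝ} (hk : 0 ≤ k) :
    G φ (k + 1) (W z - φ (W z)) ≤ G φ k (W z) :=
  h.rate.G_succ_sub_le hk (by linarith [h.one_lt_W z]) (h.one_lt_sub z hz).le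

/-! ### Counting excursions from `Δ`: the bound behind (i). -/

/-- An upper bound for the mean of `R(τ)`, where `R` is the inverse of `H` and `τ` the length of an
excursion from `Δ`, which begins with a contraction period of length `ℓ`. -/
noncomputable def excursionConst (φ : ℝ → ℝ) (ℓ : ℕ) (b M : ℝ) : ℝ := G φ ℓ (M + ℓ * b)

theorem one_le_excursionConst (h : SubgeoDrift φ Q d W Δ ℓ ε b M) :
    1 ≤ excursionConst φ ℓ b M :=
  h.rate.one_le_G (Nat.cast_nonneg ℓ) h.one_lt_M_add.le

/-- Contraction over `j` further visits to `Δ`, the excursions completed so far contributing `A`: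
the first bound holds for starting points in `Δ`, the second one in the course of an excursion
which has already lasted for a time `k`. Here `t ↦ a + ρ * t` is the tangent line of `Hinv φ`
at `θ`. -/
theorem lintegral_pow_le_excursions [IsMarkovKernel Q]
    (h : SubgeoDrift φ Q d W Δ ℓ ε b M) {m : ℝ} (hm : 0 < m)
    {θ : ℝ} (hθ : 0 ≤ θ) {ρ a C K : ℝ} (hρ : ρ = φ (Hinv φ θ)) (ha : a = Hinv φ θ - ρ * θ)
    (hC : C = excursionConst φ ℓ b M) (hK : K = m * Hinv φ θ) (n : ℕ) :
    (∀ z ∈ Δ, ∀ (j : ℕ) (A : ℝ), 0 ≤ A → (m - j) * a + ρ * (m * θ - n) ≤ A →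
      ∫⁻ p, d p ∂((Q ^ n) z) ≤
        ENNReal.ofReal (1 - ε) ^ j * d z + ENNReal.ofReal ((A + j * C) / K)) ∧
    (∀ (z : Z) (j : ℕ) (k A : ℝ), 0 ≤ k → 0 ≤ A →
      (m - j - 1) * a + ρ * (m * θ - n - k) ≤ A →
      ∫⁻ p, d p ∂((Q ^ n) z) ≤
        ENNReal.ofReal (1 - ε) ^ j * d z + ENNReal.ofReal ((A + j * C) / K)
          + ENNReal.ofReal (1 / K * G φ k (W z))) := by
  have hφ := h.rate
  have hR := hφ.Hinv_pos hθ
  have hρ0 : 0 < ρ := hρ ▸ hφ.pos hR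
  have hK0 : 0 < K := hK ▸ mul_pos hm hR
  have hL : ∀ t, 0 ≤ t → a + ρ * t ≤ Hinv φ t := fun t ht => by
    have := hφ.tangent_le_Hinv hθ ht
    rw [← hρ] at this
    linarith
  have hC1 : 1 ≤ C := hC ▸ h.one_le_excursionConst
  have hCℓ : a + ρ * ℓ ≤ C := (hL ℓ (Nat.cast_nonneg ℓ)).trans
    (hC ▸ hφ.Hinv_le_G (Nat.cast_nonneg ℓ) h.one_lt_M_add.le)
  have hCa : a ≤ C := le_trans (by nlinarith [Nat.cast_nonneg (α := ℝ) ℓ]) hCℓ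
  -- The tangent at `θ`, summed over `m` excursions of total length `m θ`, equals the threshold `K`
  -- of Markov's inequality.
  have hKa : m * a + ρ * (m * θ) = K := by rw [hK, ha]; ring
  induction n using Nat.strong_induction_on with
  | _ n ih =>
  have hB : ∀ z ∈ Δ, ∀ (j : ℕ) (A : ℝ), 0 ≤ A → (m - j) * a + ρ * (m * θ - n) ≤ A →
      ∫⁻ p, d p ∂((Q ^ n) z) ≤
        ENNReal.ofReal (1 - ε) ^ j * d z + ENNReal.ofReal ((A + j * C) / K) := by
    intro z hz j A hA0 hA
    rcases j with _ | j
    · rw [pow_zero, one_mul]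
      exact (h.lintegral_pow_le n z).trans le_self_add
    rcases lt_or_ge n ℓ with hn | hn
    -- Time runs out within the contraction period: `C ≥ a + ρ ℓ` and `C ≥ a` lift the numerator to
    -- at least `K`, so the trivial bound `1` suffices.
    · refine (h.lintegral_pow_le_one n z).trans (le_add_left ?_)
      rw [ENNReal.one_le_ofReal, le_div_iff₀ hK0, ← hKa]
      have : (n : ℝ) ≤ ℓ := by exact_mod_cast hn.le
      have hj := mul_le_mul_of_nonneg_left hCa (Nat.cast_nonneg (α := ℝ) j)
      push_cast at hA ⊢
      nlinarith
    -- One contraction is spent, and a new excursion starts with `ℓ` time units already elapsed; the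
    -- mean of its drift function is absorbed in one `C`.
    · obtain ⟨n', rfl⟩ := Nat.exists_eq_add_of_le' hn
      have hℓ := h.one_le_period
      rw [lintegral_pow_add Q h.measurable_d]
      have := h.lintegral_affine_le ((Q ^ ℓ) z) (Nat.cast_nonneg ℓ) (one_div_nonneg.2 hK0.le)
        h.one_lt_M_add (h.lintegral_pow_W_le_of_mem hz)
        (fun y => (ih n' (by omega)).2 y j ℓ A (Nat.cast_nonneg ℓ) hA0 (by
          push_cast at hA
          linarith))
      refine this.trans ?_
      rw [add_assoc, ← ENNReal.ofReal_add (by positivity)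
        (mul_nonneg (one_div_nonneg.2 hK0.le)
          (zero_le_one.trans (hφ.one_le_G (Nat.cast_nonneg ℓ) h.one_lt_M_add.le))), pow_succ,
        mul_assoc]
      gcongr
      · exact h.lintegral_pow_d_le z hz
      · change _ + 1 / K * excursionConst φ ℓ b M ≤ _
        rw [← hC]
        apply le_of_eq
        push_cast
        field_simp
        ring
  refine ⟨hB, fun z j k A hk hA0 hA => ?_⟩
  have hGk : a + ρ * k ≤ G φ k (W z) := (hL k hk).trans (hφ.Hinv_le_G hk (h.one_lt_W z).le)
  have hG1 := hφ.one_le_G hk (h.one_lt_W z).le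
  by_cases hz : z ∈ Δ
  -- The excursion ends on reaching `Δ`: its value `G φ k (W z) ≥ R(k)` joins the completed ones in
  -- `A`.
  · refine (hB z hz j (A + G φ k (W z)) (by linarith) (by linarith)).trans ?_
    rw [add_assoc (ENNReal.ofReal (1 - ε) ^ j * d z),
      ← ENNReal.ofReal_add (by positivity) (by positivity)]
    gcongr
    apply le_of_eq
    field_simp
    ring
  · rcases n with _ | n
    -- Time is used up during an excursion; the tangent bounds again bring the numerator up to `K`.
    · refine (h.lintegral_pow_le_one 0 z).trans ?_
      rw [add_assoc, ← ENNReal.ofReal_add (by positivity) (by positivity)]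
      refine le_add_left ?_
      rw [ENNReal.one_le_ofReal]
      have : (A + j * C) / K + 1 / K * G φ k (W z) = (A + j * C + G φ k (W z)) / K := by
        field_simp
      rw [this, le_div_iff₀ hK0, ← hKa]
      have hj := mul_le_mul_of_nonneg_left hCa (Nat.cast_nonneg (α := ℝ) j)
      push_cast at hA
      nlinarith
    · rw [lintegral_pow_add Q h.measurable_d, pow_one]
      have := h.lintegral_affine_le (Q z) (by linarith : 0 ≤ k + 1) (one_div_nonneg.2 hK0.le)
        (h.one_lt_sub z hz) (h.lintegral_W_le z hz)
        (fun y => (ih n (by omega)).2 y j (k + 1) A (by linarith) hA0 (by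
          push_cast at hA
          linarith))
      refine this.trans ?_
      gcongr
      · exact h.lintegral_d_le z
      · exact h.G_succ_le hz hk

theorem lintegral_pow_le_of_mem [IsMarkovKernel Q]
    (h : SubgeoDrift φ Q d W Δ ℓ ε b M) {m : ℕ} (hm : 1 ≤ m)
    {θ : ℝ} (hθ : 0 ≤ θ) {n : ℕ} (hn : m * θ ≤ n) {z : Z} (hz : z ∈ Δ) :
    ∫⁻ p, d p ∂((Q ^ n) z) ≤
      ENNReal.ofReal (1 - ε) ^ m * d z
        + ENNReal.ofReal (excursionConst φ ℓ b M / Hinv φ θ) := by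
  have hm0 : (0 : ℝ) < m := by exact_mod_cast hm
  have hR := h.rate.Hinv_pos hθ
  have := (h.lintegral_pow_le_excursions hm0 hθ rfl rfl rfl rfl n).1 z hz m 0 le_rfl (by
    rw [sub_self, zero_mul, zero_add]
    exact mul_nonpos_of_nonneg_of_nonpos (h.rate.pos hR).le (by linarith))
  rwa [zero_add, mul_div_mul_left _ _ hm0.ne'] at this

/-- The phase before the first visit to `Δ`, with `k` steps elapsed out of `N`. If `k ≥ N/2`, then
`R(N/2) ≤ G_k(W)` and the last term is at least `1`; a visit before that leaves at least `N/2 = m θ`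
steps, with `θ = N/(2m)`. -/
theorem lintegral_pow_le_add [IsMarkovKernel Q]
    (h : SubgeoDrift φ Q d W Δ ℓ ε b M) (N : ℕ) {m : ℕ} (hm : 1 ≤ m)
    (n : ℕ) : ∀ (z : Z) (k : ℝ), 0 ≤ k → n + k = N →
    ∫⁻ p, d p ∂((Q ^ n) z) ≤
      ENNReal.ofReal (1 - ε) ^ m * d z
        + ENNReal.ofReal (excursionConst φ ℓ b M / Hinv φ (N / (2 * m)))
        + ENNReal.ofReal (1 / Hinv φ (N / 2) * G φ k (W z)) := by
  have hm0 : (0 : ℝ) < m := by exact_mod_cast hm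
  have hN : (0 : ℝ) ≤ N / 2 := by positivity
  have hR := h.rate.Hinv_pos hN
  have htriv : ∀ (n : ℕ) (z : Z) (k : ℝ), (N : ℝ) / 2 ≤ k →
      ∫⁻ p, d p ∂((Q ^ n) z) ≤
      ENNReal.ofReal (1 - ε) ^ m * d z
        + ENNReal.ofReal (excursionConst φ ℓ b M / Hinv φ (N / (2 * m)))
        + ENNReal.ofReal (1 / Hinv φ (N / 2) * G φ k (W z)) := by
    intro n z k hk
    refine (h.lintegral_pow_le_one n z).trans (le_add_left ?_)
    rw [ENNReal.one_le_ofReal, one_div, ← div_eq_inv_mul, one_le_div hR]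
    exact (h.rate.Hinv_mono hN hk).trans (h.rate.Hinv_le_G (hN.trans hk) (h.one_lt_W z).le)
  induction n with
  | zero =>
    intro z k hk hnk
    apply htriv
    push_cast at hnk
    linarith
  | succ n ih =>
    intro z k hk hnk
    rcases le_total ((N : ℝ) / 2) k with hk2 | hk2
    · exact htriv _ z k hk2
    by_cases hz : z ∈ Δ
    · refine (h.lintegral_pow_le_of_mem hm (θ := N / (2 * m)) (by positivity) ?_ hz).trans
        le_self_add
      have : (m : ℝ) * (N / (2 * m)) = N / 2 := by field_simp
      rw [this]
      linarith
    · rw [lintegral_pow_add Q h.measurable_d, pow_one]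
      have := h.lintegral_affine_le (Q z) (by linarith : 0 ≤ k + 1) (one_div_nonneg.2 hR.le)
        (h.one_lt_sub z hz) (h.lintegral_W_le z hz)
        (fun y => ih y (k + 1) (by linarith) (by push_cast at hnk; linarith))
      refine this.trans ?_
      gcongr
      · exact h.lintegral_d_le z
      · exact h.G_succ_le hz hk

theorem vRate_nonneg_arg (hφ : IsSubgeoRate φ) (hε0 : 0 < ε) (hε1 : ε < 1) (n : ℕ) :
    0 ≤ -(n : ℝ) * Real.log (1 - ε) / (2 * (Real.log (Hinv φ n) - Real.log (1 - ε))) := by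
  have h1 : Real.log (1 - ε) < 0 := Real.log_neg (by linarith) (by linarith)
  have h2 : 0 ≤ Real.log (Hinv φ n) := Real.log_nonneg (hφ.one_le_Hinv (Nat.cast_nonneg n))
  apply div_nonneg _ (by linarith)
  rw [neg_mul]
  exact neg_nonneg.2 (mul_nonpos_of_nonneg_of_nonpos (Nat.cast_nonneg n) h1.le)

theorem lintegral_pow_le_vRate [IsMarkovKernel Q]
    (h : SubgeoDrift φ Q d W Δ ℓ ε b M) (n : ℕ) (z : Z) :
    ∫⁻ p, d p ∂((Q ^ n) z) ≤ ENNReal.ofReal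
      (1 / Hinv φ (n / 2) + excursionConst φ ℓ b M / vRate φ ε n + W z / Hinv φ (n / 2)) := by
  have hφ := h.rate
  have hε0 := h.eps_pos
  have hε1 := h.eps_lt_one
  have hlog : Real.log (1 - ε) < 0 := Real.log_neg (by linarith) (by linarith)
  have hn0 : (0 : ℝ) ≤ n := Nat.cast_nonneg n
  have hR := hφ.one_le_Hinv hn0
  have hR2 := hφ.Hinv_pos (by positivity : (0 : ℝ) ≤ n / 2)
  have hlogR : 0 ≤ Real.log (Hinv φ n) := Real.log_nonneg hR
  -- `x` solves `(1-ε)^x = 1/R(n)`. The integer `m` satisfies `x ≤ m ≤ x + 1`: the lower bound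
  -- controls `(1-ε)^m`, the upper one gives `v_n ≤ R(n/(2m))`, as the argument of `R` in `v_n` is
  -- `n/(2(x+1))`.
  set x : ℝ := Real.log (Hinv φ n) / (-Real.log (1 - ε)) with hx
  have hx0 : 0 ≤ x := div_nonneg hlogR (by linarith)
  set m : ℕ := ⌊x⌋₊ + 1 with hm
  have hm1 : 1 ≤ m := by omega
  have hm0 : (0 : ℝ) < m := by exact_mod_cast hm1
  have hmx : (m : ℝ) ≤ x + 1 := by
    rw [hm]; push_cast
    linarith [Nat.floor_le hx0]
  have hxm : x ≤ m := by
    rw [hm]; push_cast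
    exact (Nat.lt_floor_add_one x).le
  have hpow : (1 - ε) ^ m ≤ 1 / Hinv φ (n / 2) := by
    calc (1 - ε) ^ m = Real.exp (m * Real.log (1 - ε)) := by
          rw [mul_comm, Real.exp_mul, Real.exp_log (by linarith), Real.rpow_natCast]
      _ ≤ Real.exp (-Real.log (Hinv φ n)) := by
          apply Real.exp_le_exp.2
          have : Real.log (Hinv φ n) ≤ m * (-Real.log (1 - ε)) :=
            (div_le_iff₀ (by linarith)).1 hxm
          linarith
      _ = 1 / Hinv φ n := by rw [Real.exp_neg, Real.exp_log (by linarith), one_div]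
      _ ≤ 1 / Hinv φ (n / 2) :=
          one_div_le_one_div_of_le hR2 (hφ.Hinv_mono (by positivity) (by linarith))
  have harg := vRate_nonneg_arg hφ hε0 hε1 n
  have hv : vRate φ ε n ≤ Hinv φ (n / (2 * m)) := by
    refine hφ.Hinv_mono harg ?_
    have hx1 : -(n : ℝ) * Real.log (1 - ε) / (2 * (Real.log (Hinv φ n) - Real.log (1 - ε)))
        = n / (2 * (x + 1)) := by
      have h3 : Real.log (Hinv φ n) - Real.log (1 - ε) = (x + 1) * (-Real.log (1 - ε)) := by
        rw [hx, add_mul, div_mul_cancel₀ _ (by linarith)]; ring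
      rw [h3]
      have : Real.log (1 - ε) ≠ 0 := hlog.ne
      have : x + 1 ≠ 0 := by linarith
      field_simp
    rw [hx1]
    gcongr
  have hv0 : 0 < vRate φ ε n := hφ.Hinv_pos harg
  have hC := h.one_le_excursionConst
  have := h.lintegral_pow_le_add n hm1 n z 0 le_rfl (add_zero _)
  rw [hφ.G_zero (h.one_lt_W z).le] at this
  refine this.trans ?_
  have hW := h.one_lt_W z
  have hQ2 : 0 ≤ W z / Hinv φ (n / 2) := by positivity
  rw [ENNReal.ofReal_add (by positivity) hQ2, ENNReal.ofReal_add (by positivity) (by positivity)]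
  gcongr ?_ + ENNReal.ofReal ?_ + ENNReal.ofReal ?_
  · calc ENNReal.ofReal (1 - ε) ^ m * d z ≤ ENNReal.ofReal (1 - ε) ^ m * 1 := by
          gcongr; exact h.d_le_one z
      _ = ENNReal.ofReal ((1 - ε) ^ m) := by
          rw [mul_one, ENNReal.ofReal_pow (by linarith)]
      _ ≤ _ := ENNReal.ofReal_le_ofReal hpow
  · gcongr
  · apply le_of_eq; ring

/-! ### Hölder interpolation between contraction and drift: the bound behind (ii). -/

theorem exists_lintegral_pow_le_rpow [IsMarkovKernel Q]
    (h : SubgeoDrift φ Q d W Δ ℓ ε b M) {δ : ℝ} (hδ0 : 0 < δ)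
    (hδ1 : δ < 1) : ∃ C k₀ : ℝ, 0 ≤ C ∧ 0 ≤ k₀ ∧ ∀ (n : ℕ) (k : ℝ), k₀ ≤ k → ∀ z,
      ENNReal.ofReal (Hinv φ (n + k)) ^ δ * ∫⁻ p, d p ∂((Q ^ n) z) ≤
        ENNReal.ofReal C * (d z ^ (1 - δ) * ENNReal.ofReal (G φ k (W z)) ^ δ) := by
  have hφ := h.rate
  have hε0 := h.eps_pos
  have hε1 := h.eps_lt_one
  have he : 0 < 1 - ε := by linarith
  have hHM : 0 ≤ H φ (M + ℓ * b) := hφ.H_nonneg h.one_lt_M_add.le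
  -- The largest growth of `G` at a visit to `Δ` that the contraction compensates: `(1-ε)^(1-δ) q^δ
  -- = 1`.
  set q : ℝ := (1 - ε) ^ (-((1 - δ) / δ)) with hq
  have hq1 : 1 < q := Real.one_lt_rpow_of_pos_of_lt_one_of_neg he (by linarith)
    (neg_neg_of_pos (div_pos (by linarith) hδ0))
  have hqδ : (1 - ε) ^ (1 - δ) * q ^ δ = 1 := by
    rw [hq, ← Real.rpow_mul he.le, ← Real.rpow_add he]
    have : 1 - δ + -((1 - δ) / δ) * δ = 0 := by field_simp; ring
    rw [this, Real.rpow_zero]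
  obtain ⟨k₁, hk₁⟩ := eventually_atTop.1
    (hφ.eventually_Hinv_add_le (c := H φ (M + ℓ * b) + ℓ) (by positivity) hq1)
  refine ⟨q ^ δ, max k₁ 0, by positivity, le_max_right _ _, fun n => ?_⟩
  induction n using Nat.strong_induction_on with
  | _ n ih =>
  intro k hk z
  have hk0 : 0 ≤ k := (le_max_right _ _).trans hk
  have hqk := hk₁ k ((le_max_left _ _).trans hk)
  have hRk := hφ.Hinv_pos hk0
  have hRG : Hinv φ k ≤ G φ k (W z) := hφ.Hinv_le_G hk0 (h.one_lt_W z).le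
  rcases lt_or_ge n ℓ with hn | hn
  -- Too few steps for a contraction period; this base case is where the constant `q ^ δ` comes
  -- from.
  · have hnℓ : (n : ℝ) ≤ ℓ := by exact_mod_cast hn.le
    have h1 : Hinv φ (n + k) ≤ q * G φ k (W z) :=
      (hφ.Hinv_mono (by positivity) (by linarith)).trans (hqk.trans (by gcongr))
    calc ENNReal.ofReal (Hinv φ (n + k)) ^ δ * ∫⁻ p, d p ∂((Q ^ n) z)
        ≤ ENNReal.ofReal (q * G φ k (W z)) ^ δ * d z ^ (1 - δ) := by
          gcongr
          refine (h.lintegral_pow_le n z).trans ?_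
          conv_lhs => rw [← ENNReal.rpow_one (d z)]
          exact ENNReal.rpow_le_rpow_of_exponent_ge (h.d_le_one z) (by linarith)
      _ = ENNReal.ofReal (q ^ δ) * (d z ^ (1 - δ) * ENNReal.ofReal (G φ k (W z)) ^ δ) := by
          rw [ENNReal.ofReal_mul (by linarith), ENNReal.mul_rpow_of_nonneg _ _ hδ0.le,
            ENNReal.ofReal_rpow_of_pos (by linarith)]
          ring
  · have hmeas : ∀ k', 0 ≤ k' →
        Measurable fun y => d y ^ (1 - δ) * ENNReal.ofReal (G φ k' (W y)) ^ δ := fun k' hk' =>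
      (h.measurable_d.pow_const _).mul ((h.measurable_G hk').ennreal_ofReal.pow_const _)
    -- Running `s` steps first moves `s` from `n` to `k`, so `R(n + k)` is unchanged in the
    -- induction hypothesis.
    have hstep : ∀ r s : ℕ, 1 ≤ s → r + s = n → ∀ w₀ : ℝ, 1 < w₀ →
        ∫⁻ p, ENNReal.ofReal (W p) ∂((Q ^ s) z) ≤ ENNReal.ofReal w₀ →
        ENNReal.ofReal (Hinv φ (n + k)) ^ δ * ∫⁻ p, d p ∂((Q ^ n) z) ≤
        ENNReal.ofReal (q ^ δ) * ((∫⁻ p, d p ∂((Q ^ s) z)) ^ (1 - δ)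
          * ENNReal.ofReal (G φ (k + s) w₀) ^ δ) := by
      intro r s hs hrs w₀ hw₀ hW
      have hks : 0 ≤ k + s := by positivity
      rw [← hrs, lintegral_pow_add Q h.measurable_d,
        ← lintegral_const_mul _ (h.measurable_d.lintegral_kernel)]
      calc _ ≤ ∫⁻ y, ENNReal.ofReal (q ^ δ)
              * (d y ^ (1 - δ) * ENNReal.ofReal (G φ (k + s) (W y)) ^ δ) ∂((Q ^ s) z) := by
            refine lintegral_mono fun y => ?_
            have := ih r (by omega) (k + s) (by linarith [Nat.cast_nonneg (α := ℝ) s]) y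
            have e : ((r + s : ℕ) : ℝ) + k = r + (k + s) := by push_cast; ring
            rw [e]
            exact this
        _ ≤ _ := by
            rw [lintegral_const_mul _ (hmeas _ hks)]
            gcongr
            exact h.lintegral_rpow_le _ hks hδ0 hδ1 hw₀ hW
    by_cases hz : z ∈ Δ
    · refine (hstep (n - ℓ) ℓ h.one_le_period (by omega) _ h.one_lt_M_add
        (h.lintegral_pow_W_le_of_mem hz)).trans ?_
      have hG : G φ (k + ℓ) (M + ℓ * b) ≤ q * G φ k (W z) := by
        have : G φ (k + ℓ) (M + ℓ * b) = Hinv φ (k + (H φ (M + ℓ * b) + ℓ)) := by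
          rw [G]; congr 1; ring
        rw [this]
        exact hqk.trans (by gcongr)
      gcongr ENNReal.ofReal (q ^ δ) * ?_
      calc (∫⁻ p, d p ∂((Q ^ ℓ) z)) ^ (1 - δ) * ENNReal.ofReal (G φ (k + ℓ) (M + ℓ * b)) ^ δ
          ≤ (ENNReal.ofReal (1 - ε) * d z) ^ (1 - δ) * ENNReal.ofReal (q * G φ k (W z)) ^ δ := by
            gcongr
            exact h.lintegral_pow_d_le z hz
        _ = ENNReal.ofReal ((1 - ε) ^ (1 - δ) * q ^ δ)
            * (d z ^ (1 - δ) * ENNReal.ofReal (G φ k (W z)) ^ δ) := by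
            rw [ENNReal.ofReal_mul (by linarith : 0 ≤ q), ENNReal.mul_rpow_of_nonneg _ _ hδ0.le,
              ENNReal.mul_rpow_of_nonneg _ _ (by linarith), ENNReal.ofReal_mul (by positivity),
              ENNReal.ofReal_rpow_of_pos he, ENNReal.ofReal_rpow_of_pos (by linarith)]
            ring
        _ = _ := by rw [hqδ, ENNReal.ofReal_one, one_mul]
    · have hℓ := h.one_le_period
      refine (hstep (n - 1) 1 le_rfl (by omega) _ (h.one_lt_sub z hz)
        (by rw [pow_one]; exact h.lintegral_W_le z hz)).trans ?_
      rw [pow_one, Nat.cast_one]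
      gcongr
      · exact h.lintegral_d_le z
      · exact h.G_succ_le hz hk0

theorem exists_lintegral_pow_le_div [IsMarkovKernel Q]
    (h : SubgeoDrift φ Q d W Δ ℓ ε b M) {δ : ℝ} (hδ0 : 0 < δ)
    (hδ1 : δ < 1) : ∃ C : ℝ, 0 ≤ C ∧ ∀ (n : ℕ) (z : Z),
      ∫⁻ p, d p ∂((Q ^ n) z) ≤ ENNReal.ofReal (C * W z / Hinv φ n ^ δ) := by
  have hφ := h.rate
  obtain ⟨C, k₀, hC, hk₀, hmain⟩ := h.exists_lintegral_pow_le_rpow hδ0 hδ1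
  -- Any tangent of the concave `G φ k₀` bounds it by a multiple of `W`; the base point `2` is
  -- arbitrary.
  obtain ⟨g, hg, htan⟩ := hφ.exists_G_le_tangent hk₀ one_lt_two
  have hG2 := hφ.one_le_G hk₀ one_lt_two.le
  refine ⟨C * (G φ k₀ 2 + g), by positivity, fun n z => ?_⟩
  have hn : (0 : ℝ) ≤ n := Nat.cast_nonneg n
  have hRn := hφ.Hinv_pos hn
  have hW := h.one_lt_W z
  have hG1 := hφ.one_le_G hk₀ hW.le
  have hGW : G φ k₀ (W z) ≤ (G φ k₀ 2 + g) * W z := by nlinarith [htan (W z) hW]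
  have h1 : ENNReal.ofReal (Hinv φ n ^ δ) * ∫⁻ p, d p ∂((Q ^ n) z)
      ≤ ENNReal.ofReal (C * (G φ k₀ 2 + g) * W z) := by
    calc ENNReal.ofReal (Hinv φ n ^ δ) * ∫⁻ p, d p ∂((Q ^ n) z)
        ≤ ENNReal.ofReal (Hinv φ (n + k₀)) ^ δ * ∫⁻ p, d p ∂((Q ^ n) z) := by
          rw [← ENNReal.ofReal_rpow_of_pos hRn]
          gcongr
          exact hφ.Hinv_mono hn (by linarith)
      _ ≤ ENNReal.ofReal C * (d z ^ (1 - δ) * ENNReal.ofReal (G φ k₀ (W z)) ^ δ) :=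
          hmain n k₀ le_rfl z
      _ ≤ ENNReal.ofReal C * (1 * ENNReal.ofReal ((G φ k₀ 2 + g) * W z)) := by
          gcongr
          · exact ENNReal.rpow_le_one (h.d_le_one z) (by linarith)
          · rw [ENNReal.ofReal_rpow_of_pos (by linarith)]
            refine ENNReal.ofReal_le_ofReal (le_trans ?_ hGW)
            exact Real.rpow_le_self_of_one_le hG1 hδ1.le
      _ = _ := by rw [one_mul, ← ENNReal.ofReal_mul hC, mul_assoc]
  have hp : 0 < Hinv φ n ^ δ := Real.rpow_pos_of_pos hRn δ
  rw [ENNReal.ofReal_div_of_pos hp,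
    ENNReal.le_div_iff_mul_le (Or.inl (by simpa using hp)) (Or.inl ENNReal.ofReal_ne_top), mul_comm]
  exact h1

end SubgeoDrift

/-! ### From the coupling kernel to the Wasserstein distance, and integration against `π`. -/

theorem map_pow_apply {Z E : Type*} [MeasurableSpace Z] [MeasurableSpace E] {P : Kernel E E}
    {Q : Kernel Z Z} {f : Z → E} (hf : Measurable f) (h : ∀ z, (Q z).map f = P (f z)) (n : ℕ)
    (z : Z) : ((Q ^ n) z).map f = (P ^ n) (f z) := by
  induction n with
  | zero =>
    have h1 : Q ^ 0 = Kernel.id := pow_zero Q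
    have h2 : P ^ 0 = Kernel.id := pow_zero P
    rw [h1, h2, Kernel.id_apply, Kernel.id_apply, Measure.map_dirac' hf]
  | succ n ih =>
    ext s hs
    rw [add_comm n 1, Kernel.pow_add, Kernel.pow_add, pow_one, pow_one, Measure.map_apply hf hs,
      Kernel.comp_apply' _ _ _ (hf hs), Kernel.comp_apply' _ _ _ hs, ← ih,
      lintegral_map (P.measurable_coe hs) hf]
    refine lintegral_congr fun y => ?_
    rw [← h y, Measure.map_apply hf hs]

theorem invariant_pow {E : Type*} [MeasurableSpace E] {P : Kernel E E} {π : Measure E}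
    (hπ : Kernel.Invariant P π) (n : ℕ) : Kernel.Invariant (P ^ n) π := by
  induction n with
  | zero =>
    have h : P ^ 0 = Kernel.id := pow_zero P
    rw [h, Kernel.Invariant, Measure.id_comp]
  | succ n ih => exact ih.comp hπ

theorem lintegral_lintegral_of_invariant {E : Type*} [MeasurableSpace E] {P : Kernel E E}
    {π : Measure E} (hπ : Kernel.Invariant P π) {f : E → ℝ≥0∞} (hf : Measurable f) :
    ∫⁻ x, ∫⁻ y, f y ∂(P x) ∂π = ∫⁻ x, f x ∂π := by
  rw [← Measure.lintegral_bind P.aemeasurable hf.aemeasurable, hπ.def]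

/-- The law at time `n` of the coupled chain started from `δ_x ⊗ π` has marginals `P^n(x,·)` and `π
P^n = π`. -/
theorem wasserstein_pow_le {E : Type*} [MetricSpace E] [SecondCountableTopology E]
    [MeasurableSpace E] [BorelSpace E] {P : Kernel E E} [IsMarkovKernel P]
    {Q : Kernel (E × E) (E × E)} (hQ : IsCouplingKernel P Q) {π : Measure E}
    [IsProbabilityMeasure π] (hπ : Kernel.Invariant P π) (n : ℕ) (x : E) :
    wasserstein ((P ^ n) x) π ≤ ∫⁻ y, ∫⁻ p, edist p.1 p.2 ∂((Q ^ n) (x, y)) ∂π := by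
  have hx : Measurable (Prod.mk x : E → E × E) := measurable_prodMk_left
  set γ : Measure (E × E) := (π.map (Prod.mk x)).bind ⇑(Q ^ n) with hγ
  have hγs : ∀ s, MeasurableSet s → γ s = ∫⁻ y, (Q ^ n) (x, y) s ∂π := fun s hs => by
    rw [hγ, Measure.bind_apply hs (Kernel.aemeasurable _),
      lintegral_map ((Q ^ n).measurable_coe hs) hx]
  have hmem : γ ∈ couplings ((P ^ n) x) π := by
    constructor
    · ext s hs
      rw [Measure.map_apply measurable_fst hs, hγs _ (measurable_fst hs)]
      have : ∀ y, (Q ^ n) (x, y) (Prod.fst ⁻¹' s) = (P ^ n) x s := fun y => by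
        rw [← Measure.map_apply measurable_fst hs,
          map_pow_apply (P := P) measurable_fst (fun z => (hQ z.1 z.2).1)]
      simp [this]
    · ext s hs
      rw [Measure.map_apply measurable_snd hs, hγs _ (measurable_snd hs)]
      have : ∀ y, (Q ^ n) (x, y) (Prod.snd ⁻¹' s) = (P ^ n) y s := fun y => by
        rw [← Measure.map_apply measurable_snd hs,
          map_pow_apply (P := P) measurable_snd (fun z => (hQ z.1 z.2).2)]
      simp only [this]
      rw [← Measure.bind_apply hs (Kernel.aemeasurable _), (invariant_pow hπ n).def]
  refine (iInf₂_le γ hmem).trans_eq ?_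
  rw [hγ, Measure.lintegral_bind (Kernel.aemeasurable _) measurable_edist.aemeasurable,
    lintegral_map measurable_edist.lintegral_kernel hx]

theorem IsSubgeoRate.measurable_comp {φ : ℝ → ℝ} (hφ : IsSubgeoRate φ) {E : Type*}
    [MeasurableSpace E] {V : E → ℝ} (hV : Measurable V) (hV1 : ∀ x, 1 ≤ V x) :
    Measurable fun x => φ (V x) := by
  have hm : Monotone fun v => φ (max v 1) := fun v w h =>
    hφ.mono (zero_le_one.trans (le_max_right _ _)) (max_le_max_right 1 h)
  simpa [Function.comp_def, max_eq_left (hV1 _)] using hm.measurable.comp hV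

/-- Integrating the drift inequality against `π` cancels the `V` terms by invariance. As `V` need
not be `π`-integrable, it is first truncated at `N`, which preserves the inequality with `φ(V)`
restricted to `{V ≤ N}`; then `N → ∞`. -/
theorem lintegral_rate_le {E : Type*} [MeasurableSpace E] {P : Kernel E E} [IsMarkovKernel P]
    {φ : ℝ → ℝ} (hφ : IsSubgeoRate φ) {V : E → ℝ} (hVm : Measurable V) (hV1 : ∀ x, 1 ≤ V x) {b : ℝ}
    (hdrift : ∀ x, 2 * ∫⁻ z, ENNReal.ofReal (V z) ∂(P x) + ENNReal.ofReal (φ (V x)) ≤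
      2 * ENNReal.ofReal (V x) + ENNReal.ofReal b)
    {π : Measure E} [IsProbabilityMeasure π] (hπ : Kernel.Invariant P π) :
    ∫⁻ y, ENNReal.ofReal (φ (V y)) ∂π ≤ ENNReal.ofReal b := by
  have hφm := (hφ.measurable_comp hVm hV1).ennreal_ofReal
  have hs : ∀ N : ℕ, MeasurableSet {y | V y ≤ N} := fun N => measurableSet_le hVm measurable_const
  have htrunc : ∀ N : ℕ, ∫⁻ y in {y | V y ≤ N}, ENNReal.ofReal (φ (V y)) ∂π
      ≤ ENNReal.ofReal b := by
    intro N
    set g : E → ℝ≥0∞ := fun y => ENNReal.ofReal (min (V y) N) with hg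
    have hgm : Measurable g := (hVm.min measurable_const).ennreal_ofReal
    have hgN : ∀ y, g y ≤ ENNReal.ofReal N := fun y =>
      ENNReal.ofReal_le_ofReal (min_le_right _ _)
    have hpt : ∀ x, 2 * ∫⁻ z, g z ∂(P x)
        + {y | V y ≤ N}.indicator (fun y => ENNReal.ofReal (φ (V y))) x
        ≤ 2 * g x + ENNReal.ofReal b := by
      intro x
      by_cases hx : V x ≤ N
      · rw [Set.indicator_of_mem (by exact hx), hg]
        simp only [min_eq_left hx]
        refine le_trans ?_ (hdrift x)
        gcongr
        exact min_le_left _ _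
      · rw [Set.indicator_of_notMem (by exact hx), add_zero]
        have : g x = ENNReal.ofReal N := by
          simp only [hg, min_eq_right (not_le.1 hx).le]
        rw [this]
        refine le_trans ?_ le_self_add
        gcongr
        exact (lintegral_mono hgN).trans (by simp)
    have hint : 2 * ∫⁻ y, g y ∂π + ∫⁻ y in {y | V y ≤ N}, ENNReal.ofReal (φ (V y)) ∂π
        ≤ 2 * ∫⁻ y, g y ∂π + ENNReal.ofReal b := by
      calc _ = ∫⁻ x, (2 * ∫⁻ z, g z ∂(P x)
            + {y | V y ≤ N}.indicator (fun y => ENNReal.ofReal (φ (V y))) x) ∂π := by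
            rw [lintegral_add_left (hgm.lintegral_kernel.const_mul 2),
              lintegral_const_mul _ hgm.lintegral_kernel, lintegral_lintegral_of_invariant hπ hgm,
              lintegral_indicator (hs N)]
        _ ≤ ∫⁻ x, (2 * g x + ENNReal.ofReal b) ∂π := lintegral_mono hpt
        _ = _ := by
            rw [lintegral_add_left (hgm.const_mul 2), lintegral_const_mul _ hgm]
            simp
    refine (ENNReal.add_le_add_iff_left ?_).1 hint
    refine ENNReal.mul_ne_top (by simp) (ne_top_of_le_ne_top ENNReal.ofReal_ne_top
      ((lintegral_mono hgN).trans (by simp) : _ ≤ ENNReal.ofReal N))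
  have hU : ⋃ N : ℕ, {y | V y ≤ N} = Set.univ :=
    Set.eq_univ_of_forall fun y => Set.mem_iUnion.2 (exists_nat_ge (V y))
  rw [← setLIntegral_univ, ← hU, setLIntegral_iUnion_of_directed]
  · exact iSup_le htrunc
  · exact Monotone.directed_le fun m n hmn y (hy : V y ≤ m) =>
      hy.trans (Nat.cast_le.2 hmn)

/-- Only `φ(V)` is known to be integrable, and `min(1, V(y)/S) ≤ φ(V(y))/φ(S)`: for `V(y) ≤ S`
because `φ(t)/t` is nonincreasing, for `V(y) ≥ S` by monotonicity. -/
theorem lintegral_le_of_le_one {E : Type*} [MeasurableSpace E] {φ : ℝ → ℝ} (hφ : IsSubgeoRate φ)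
    {V : E → ℝ} (hVm : Measurable V) (hV1 : ∀ x, 1 ≤ V x) {π : Measure E} [IsProbabilityMeasure π]
    {B : ℝ} (hB : 0 ≤ B) (hπV : ∫⁻ y, ENNReal.ofReal (φ (V y)) ∂π ≤ ENNReal.ofReal B)
    {f : E → ℝ≥0∞} (hf1 : ∀ y, f y ≤ 1) {α κ S : ℝ} (hα : 0 ≤ α) (hκ : 1 ≤ κ) (hS : 0 < S) {x : E}
    (hf : ∀ y, f y ≤ ENNReal.ofReal (α + κ * (V x + V y) / S)) :
    ∫⁻ y, f y ∂π ≤ ENNReal.ofReal (α + κ * V x / S + κ * B / φ S) := by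
  have hφS := hφ.pos hS
  have hx := hV1 x
  have hc : 0 ≤ α + κ * V x / S := by positivity
  have hpt : ∀ y, f y ≤ ENNReal.ofReal (α + κ * V x / S)
      + ENNReal.ofReal (κ / φ S) * ENNReal.ofReal (φ (V y)) := by
    intro y
    have hy : 0 < V y := zero_lt_one.trans_le (hV1 y)
    have hφy := hφ.pos hy
    rw [← ENNReal.ofReal_mul (by positivity), ← ENNReal.ofReal_add hc (by positivity)]
    rcases le_total (V y) S with h | h
    · refine (hf y).trans (ENNReal.ofReal_le_ofReal ?_)
      have h1 : V y / S ≤ φ (V y) / φ S := by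
        rw [div_le_div_iff₀ hS hφS]
        linarith [hφ.mul_apply_le_mul_apply hy h]
      calc α + κ * (V x + V y) / S = α + κ * V x / S + κ * (V y / S) := by ring
        _ ≤ α + κ * V x / S + κ * (φ (V y) / φ S) := by gcongr
        _ = _ := by ring
    · refine (hf1 y).trans ?_
      rw [ENNReal.one_le_ofReal]
      have h1 : 1 ≤ φ (V y) / φ S := (one_le_div hφS).2 (hφ.mono hS.le h)
      have h2 : κ / φ S * φ (V y) = κ * (φ (V y) / φ S) := by ring
      rw [h2]
      nlinarith
  calc ∫⁻ y, f y ∂π ≤ ∫⁻ y, (ENNReal.ofReal (α + κ * V x / S)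
      + ENNReal.ofReal (κ / φ S) * ENNReal.ofReal (φ (V y))) ∂π := lintegral_mono hpt
    _ = ENNReal.ofReal (α + κ * V x / S)
        + ENNReal.ofReal (κ / φ S) * ∫⁻ y, ENNReal.ofReal (φ (V y)) ∂π := by
        rw [lintegral_add_left measurable_const,
          lintegral_const_mul _ (hφ.measurable_comp hVm hV1).ennreal_ofReal]
        simp
    _ ≤ ENNReal.ofReal (α + κ * V x / S) + ENNReal.ofReal (κ / φ S) * ENNReal.ofReal B := by
        gcongr
    _ = _ := by
        rw [← ENNReal.ofReal_mul (by positivity), ← ENNReal.ofReal_add hc (by positivity)]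
        congr 1
        ring

theorem IsCouplingKernel.isMarkovKernel {E : Type*} [MeasurableSpace E] {P : Kernel E E}
    [IsMarkovKernel P] {Q : Kernel (E × E) (E × E)} (hQ : IsCouplingKernel P Q) :
    IsMarkovKernel Q := by
  refine ⟨fun z => ⟨?_⟩⟩
  have h := congrArg (fun μ : Measure E => μ Set.univ) (hQ z.1 z.2).1
  simpa [Measure.map_apply measurable_fst MeasurableSet.univ] using h

theorem IsCouplingKernel.lintegral_add {E : Type*} [MeasurableSpace E] {P : Kernel E E}
    {Q : Kernel (E × E) (E × E)} (hQ : IsCouplingKernel P Q) {f : E → ℝ≥0∞} (hf : Measurable f)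
    (x y : E) : ∫⁻ p, (f p.1 + f p.2) ∂(Q (x, y)) = ∫⁻ z, f z ∂(P x) + ∫⁻ z, f z ∂(P y) := by
  rw [lintegral_add_left (f := fun p : E × E => f p.1) (hf.comp measurable_fst),
    ← (hQ x y).1, ← (hQ x y).2, lintegral_map hf measurable_fst, lintegral_map hf measurable_snd]

theorem exists_subgeoDrift {E : Type*} [MetricSpace E]
    [SecondCountableTopology E] [MeasurableSpace E] [BorelSpace E] (hd : ∀ x y : E, dist x y ≤ 1)
    {P : Kernel E E} [IsMarkovKernel P] {Δ : Set (E × E)} {ℓ : ℕ} (hℓ : 1 ≤ ℓ) {ε : ℝ}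
    (hε0 : 0 < ε) (hε1 : ε < 1) {Q : Kernel (E × E) (E × E)} (hQ : IsCouplingKernel P Q)
    (hQd : ∀ x y : E, ∫⁻ p, edist p.1 p.2 ∂(Q (x, y)) ≤ edist x y)
    (hQΔ : ∀ x y : E, (x, y) ∈ Δ →
      ∫⁻ p, edist p.1 p.2 ∂((Q ^ ℓ) (x, y)) ≤ ENNReal.ofReal (1 - ε) * edist x y)
    {φ : ℝ → ℝ} (hφ : IsSubgeoRate φ) {V : E → ℝ} (hVm : Measurable V) (hV1 : ∀ x, 1 ≤ V x)
    (hdrift : DriftCondition P Δ φ V) :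
    ∃ b M : ℝ, SubgeoDrift φ Q (fun p => edist p.1 p.2) (fun p => V p.1 + V p.2) Δ ℓ ε b M ∧
      ∀ x, 2 * ∫⁻ z, ENNReal.ofReal (V z) ∂(P x) + ENNReal.ofReal (φ (V x)) ≤
        2 * ENNReal.ofReal (V x) + ENNReal.ofReal b := by
  obtain ⟨⟨b, hb⟩, M, hM⟩ := hdrift
  have hPV : ∀ x, 1 ≤ ∫⁻ z, ENNReal.ofReal (V z) ∂(P x) := fun x => by
    calc (1 : ℝ≥0∞) = ∫⁻ _, 1 ∂(P x) := by simp
      _ ≤ _ := lintegral_mono fun z => ENNReal.one_le_ofReal.2 (hV1 z)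
  have hQW : ∀ z : E × E, ∫⁻ p, ENNReal.ofReal (V p.1 + V p.2) ∂(Q z) =
      ∫⁻ y, ENNReal.ofReal (V y) ∂(P z.1) + ∫⁻ y, ENNReal.ofReal (V y) ∂(P z.2) := fun z => by
    rw [← hQ.lintegral_add hVm.ennreal_ofReal z.1 z.2]
    exact lintegral_congr fun p => ENNReal.ofReal_add (by linarith [hV1 p.1])
      (by linarith [hV1 p.2])
  have hle : ∀ x y, ∫⁻ z, ENNReal.ofReal (V z) ∂(P x) + ∫⁻ z, ENNReal.ofReal (V z) ∂(P y) ≤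
      ENNReal.ofReal (V x + V y - φ (V x + V y) + max b 0) := fun x y => by
    refine (hb x y).trans (ENNReal.ofReal_le_ofReal ?_)
    split_ifs
    · linarith [le_max_left b 0]
    · linarith [le_max_right b 0]
  have hoff : ∀ z : E × E, z ∉ Δ → ∫⁻ y, ENNReal.ofReal (V y) ∂(P z.1)
      + ∫⁻ y, ENNReal.ofReal (V y) ∂(P z.2) ≤
      ENNReal.ofReal (V z.1 + V z.2 - φ (V z.1 + V z.2)) := fun z hz => by
    have := hb z.1 z.2
    rwa [if_neg hz, mul_zero, add_zero] at this
  have hVnn : ∀ x y, 0 ≤ φ (V x + V y) := fun x y =>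
    hφ.nonneg _ (by linarith [hV1 x, hV1 y])
  refine ⟨max b 0, max M 2, ⟨hφ, measurable_edist, (hVm.comp measurable_fst).add
    (hVm.comp measurable_snd), fun z => ?_, fun z => ?_, hℓ, hε0, hε1, le_max_right _ _,
    one_lt_two.trans_le (le_max_right _ _), fun z hz => ?_, fun z => hQd z.1 z.2,
    fun z hz => hQΔ z.1 z.2 hz, fun z hz => ?_, fun z hz => ?_, fun z => ?_⟩, fun x => ?_⟩
  · rw [edist_dist]
    exact ENNReal.ofReal_le_one.2 (hd _ _)
  · linarith [hV1 z.1, hV1 z.2]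
  · exact (hM (Set.mem_image_of_mem _ hz)).trans (le_max_left _ _)
  -- As `V ≥ 1`, the left side of the drift inequality is at least `2`, hence `W - φ(W) ≥ 2` off
  -- `Δ`.
  · have h := (add_le_add (hPV z.1) (hPV z.2)).trans (hoff z hz)
    have h2 : ENNReal.ofReal 2 ≤ ENNReal.ofReal (V z.1 + V z.2 - φ (V z.1 + V z.2)) := by
      rw [ENNReal.ofReal_ofNat, ← one_add_one_eq_two]; exact h
    rw [ENNReal.ofReal_le_ofReal_iff'] at h2
    rcases h2 with h2 | h2 <;> linarith
  · rw [hQW]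
    exact hoff z hz
  · rw [hQW]
    refine (hle z.1 z.2).trans (ENNReal.ofReal_le_ofReal ?_)
    linarith [hVnn z.1 z.2]
  -- A drift inequality for `P` alone comes from the diagonal `x = y`, with `φ(2V) ≥ φ(V)`.
  · have h := (add_le_add (hPV x) (hPV x)).trans (hle x x)
    have hpos : 0 < V x + V x - φ (V x + V x) + max b 0 := by
      by_contra! hn
      rw [ENNReal.ofReal_of_nonpos hn] at h
      simp at h
    have hx := hV1 x
    have hφx := hφ.nonneg (V x) (by linarith)
    have hmono := hφ.mono (s := V x) (t := V x + V x) (by linarith) (by linarith)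
    rw [two_mul]
    refine (add_le_add_left (hle x x) _).trans ?_
    rw [two_mul, ← ENNReal.ofReal_add hpos.le hφx,
      ← ENNReal.ofReal_add (by linarith) (by linarith),
      ← ENNReal.ofReal_add (by linarith) (le_max_right _ _)]
    exact ENNReal.ofReal_le_ofReal (by linarith)

end SubgeoWasserstein

theorem mainTheorem3 {E : Type*} [MetricSpace E] [PolishSpace E] [MeasurableSpace E] [BorelSpace E]
    (hd : ∀ x y : E, dist x y ≤ 1)
    (P : Kernel E E) [IsMarkovKernel P]
    (Δ : Set (E × E)) (hΔ : MeasurableSet Δ)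
    (ℓ : ℕ) (hℓ : 1 ≤ ℓ) (ε : ℝ) (hε0 : 0 < ε) (hε1 : ε < 1)
    (hcontr : SubgeoWasserstein.ContractionCondition P Δ ℓ ε)
    (φ : ℝ → ℝ) (hφ : SubgeoWasserstein.IsSubgeoRate φ)
    (V : E → ℝ) (hVmeas : Measurable V) (hV1 : ∀ x, 1 ≤ V x)
    (hdrift : SubgeoWasserstein.DriftCondition P Δ φ V)
    (π : Measure E) [IsProbabilityMeasure π] (hπ : Kernel.Invariant P π) :
    (∃ C : ℝ, ∀ (x : E) (n : ℕ),
      SubgeoWasserstein.wasserstein ((P ^ n) x) π ≤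
        ENNReal.ofReal
          (C * (V x + 1) / SubgeoWasserstein.Hinv φ ((n : ℝ) / 2)
            + C / φ (SubgeoWasserstein.Hinv φ ((n : ℝ) / 2))
            + C / SubgeoWasserstein.vRate φ ε n)) ∧
    (∀ δ : ℝ, 0 < δ → δ < 1 → ∃ C : ℝ, ∀ (x : E) (n : ℕ),
      SubgeoWasserstein.wasserstein ((P ^ n) x) π ≤
        ENNReal.ofReal
          (C * (V x + 1) / SubgeoWasserstein.Hinv φ (n : ℝ) ^ δ
            + C / φ (SubgeoWasserstein.Hinv φ (n : ℝ) ^ δ))) := by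
  obtain ⟨Q, hQ, hQd, hQΔ⟩ := hcontr
  have := hQ.isMarkovKernel
  obtain ⟨b, M, h, hb⟩ := SubgeoWasserstein.exists_subgeoDrift hd hℓ hε0 hε1 hQ hQd hQΔ hφ hVmeas
    hV1 hdrift
  have hb0 := h.b_nonneg
  have hπV := SubgeoWasserstein.lintegral_rate_le hφ hVmeas hV1 hb hπ
  refine ⟨?_, fun δ hδ0 hδ1 => ?_⟩
  · have hC := h.one_le_excursionConst
    set C₀ := SubgeoWasserstein.SubgeoDrift.excursionConst φ ℓ b M
    refine ⟨1 + C₀ + b, fun x n => ?_⟩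
    have hR := hφ.Hinv_pos (by positivity : (0 : ℝ) ≤ n / 2)
    have hv : 0 < SubgeoWasserstein.vRate φ ε n :=
      hφ.Hinv_pos (SubgeoWasserstein.SubgeoDrift.vRate_nonneg_arg hφ hε0 hε1 n)
    have hφR := hφ.pos hR
    have hx := hV1 x
    refine (SubgeoWasserstein.wasserstein_pow_le hQ hπ n x).trans
      -- Here `S = R(n/2)` and `κ = 1`; the summand `1/R(n/2)` of `α` becomes the `+ 1` in `V x +
      -- 1`.
      ((SubgeoWasserstein.lintegral_le_of_le_one hφ hVmeas hV1 hb0 hπV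
        (fun y => h.lintegral_pow_le_one n (x, y))
        (α := 1 / SubgeoWasserstein.Hinv φ (n / 2) + C₀ / SubgeoWasserstein.vRate φ ε n) (x := x)
        (by positivity) le_rfl hR
        (fun y => by
          rw [one_mul]
          exact h.lintegral_pow_le_vRate n (x, y))).trans (ENNReal.ofReal_le_ofReal ?_))
    calc _ = 1 * (V x + 1) / SubgeoWasserstein.Hinv φ (n / 2)
          + b / φ (SubgeoWasserstein.Hinv φ (n / 2)) + C₀ / SubgeoWasserstein.vRate φ ε n := by
          ring
      _ ≤ _ := by gcongr <;> linarith
  · obtain ⟨C, hC, hbound⟩ := h.exists_lintegral_pow_le_div hδ0 hδ1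
    refine ⟨(C + 1) * (1 + b), fun x n => ?_⟩
    have hR := Real.rpow_pos_of_pos (hφ.Hinv_pos (Nat.cast_nonneg (α := ℝ) n)) δ
    have hφR := hφ.pos hR
    have hx := hV1 x
    refine (SubgeoWasserstein.wasserstein_pow_le hQ hπ n x).trans
      -- Here `S = R(n)^δ`; `κ = C + 1` rather than `C` ensures `κ ≥ 1`.
      ((SubgeoWasserstein.lintegral_le_of_le_one hφ hVmeas hV1 hb0 hπV
        (fun y => h.lintegral_pow_le_one n (x, y)) (κ := C + 1) (x := x) le_rfl (by linarith) hR
        (fun y => (hbound n (x, y)).trans (ENNReal.ofReal_le_ofReal ?_))).trans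
          (ENNReal.ofReal_le_ofReal ?_))
    · have hy := hV1 y
      rw [zero_add]
      gcongr
      linarith
    · rw [zero_add]
      gcongr
      · nlinarith
      · linarith
      · linarith
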